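/- Let $d,m$ be natural numbers, let $P,Q,f_1,\dots,f_m\in\mathcal D(\mathbb R^d)'$ be complex valued Schwartz distributions, and let $b_1,\dots,b_m,c_1,\dots,c_m\in GL_d(\mathbb R)$ be such that $b_i^{-1}c_i-b_j^{-1}c_j$ is invertible whenever $i\neq j$. For $f\in\mathcal D(\mathbb R^d)'$ and $b,c\in GL_d(\mathbb R)$ let $f(bx+cy)\in\mathcal D(\mathbb R^d\times\mathbb R^d)'$ be the distribution that maps a test function $\varphi$ to the value of $f$ at the test function $u\mapsto |\det b|^{-1}|\det c|^{-1}\int_{\mathbb R^d}\varphi(b^{-1}(u-v),c^{-1}v)\,dv$; let $P(x)\cdot 1(y)$ map $\varphi$ to the value of $P$ at $x\mapsto\int\varphi(x,y)\,dy$, and let $1(x)\cdot Q(y)$ map $\varphi$ to the value of $Q$ at $y\mapsto\int\varphi(x,y)\,dx$. Suppose that $$\sum_{i=1}^m f_i(b_ix+c_iy)=P(x)\cdot 1(y)+1(x)\cdot Q(y)\quad\text{in }\mathcal D(\mathbb R^d\times\mathbb R^d)'.$$ Then $P$ and $Q$ are, in the distributional sense (that is, as integration against a function), polynomials in $d$ real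 variables with complex coefficients, of total degree at most $m$. Furthermore, if $Q=0$, then $P$ is a polynomial of degree at most $m-1$, and if $P=0$, then $Q$ is a polynomial of degree at most $m-1$ (the zero polynomial being the only one of negative degree). -/

import Mathlib

set_option linter.unusedSectionVars false

open MeasureTheory Set TopologicalSpace
open scoped Distributions ContDiff

namespace DistEq

section MkSupportedIn

variable {E F : Type} [NormedAddCommGroup E] [NormedSpace ℝ E]
  [NormedAddCommGroup F] [NormedSpace ℝ F]

/-- Constructor for continuous linear maps between the Fréchet spaces of smooth functions supported
in fixed compact sets of two possibly different spaces. -/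
noncomputable def mkSupportedIn {K : Compacts F} {K' : Compacts E} (A : 𝓓_{K}(F, ℝ) → E → ℝ)
    (hadd : ∀ φ ψ x, A (φ + ψ) x = A φ x + A ψ x)
    (hsmul : ∀ (c : ℝ) φ x, A (c • φ) x = c • A φ x)
    (hsmooth : ∀ φ, ContDiff ℝ ∞ (A φ))
    (hsupp : ∀ φ, ∀ x ∉ K', A φ x = 0)
    (hbound : ∀ i : ℕ, ∃ C : ℝ, 0 ≤ C ∧ ∀ φ, ∀ x,
      ‖iteratedFDeriv ℝ i (A φ) x‖ ≤ C * ContDiffMapSupportedIn.seminorm ℝ F ℝ ⊤ K i φ) :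
    𝓓_{K}(F, ℝ) →L[ℝ] 𝓓_{K'}(E, ℝ) :=
  letI Φ : 𝓓_{K}(F, ℝ) →ₗ[ℝ] 𝓓_{K'}(E, ℝ) :=
    { toFun φ := ⟨A φ, hsmooth φ, fun x hx => hsupp φ x hx⟩
      map_add' φ ψ := ContDiffMapSupportedIn.ext (hadd φ ψ)
      map_smul' c φ := ContDiffMapSupportedIn.ext (hsmul c φ) }
  { toLinearMap := Φ
    cont := show Continuous Φ by
      refine WithSeminorms.continuous_of_isBounded (ContDiffMapSupportedIn.withSeminorms ..)
        (ContDiffMapSupportedIn.withSeminorms ..) _ (.of_real fun i => ?_)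
      obtain ⟨C, hC, h⟩ := hbound i
      refine ⟨{i}, C, fun φ => ?_⟩
      rw [Finset.sup_singleton]
      exact ((Φ φ).seminorm_top_le_iff ℝ (mul_nonneg hC (apply_nonneg _ _)) i).2
        fun x _ => h φ x }

end MkSupportedIn

section PartialIntegral

variable {E F : Type} [NormedAddCommGroup E] [NormedSpace ℝ E]
  [NormedAddCommGroup F] [NormedSpace ℝ F] [MeasureSpace F] [BorelSpace F]
  [IsFiniteMeasureOnCompacts (volume : Measure F)]

theorem integrable_slice {G : Type} [NormedAddCommGroup G] [NormedSpace ℝ G]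
    {K : Set F} (hK : IsCompact K) {f : E × F → G} (hf : Continuous f)
    (hs : ∀ p : E × F, p.2 ∉ K → f p = 0) (x : E) :
    Integrable (fun y => f (x, y)) := by
  have h1 : Continuous fun y => f (x, y) := hf.comp (by fun_prop)
  exact h1.integrable_of_hasCompactSupport
    (HasCompactSupport.intro hK fun y hy => hs (x, y) hy)

theorem fderiv_eq_zero_off {G : Type} [NormedAddCommGroup G] [NormedSpace ℝ G]
    {K : Set F} (hK : IsCompact K) {f : E × F → G}
    (hs : ∀ p : E × F, p.2 ∉ K → f p = 0) (p : E × F) (hp : p.2 ∉ K) :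
    fderiv ℝ f p = 0 := by
  have : f =ᶠ[nhds p] fun _ => 0 := by
    have ho : IsOpen {q : E × F | q.2 ∉ K} :=
      hK.isClosed.isOpen_compl.preimage continuous_snd
    filter_upwards [ho.mem_nhds hp] with q hq using hs q hq
  rw [this.fderiv_eq]
  simp

theorem hasFDerivAt_partialIntegral {G : Type} [NormedAddCommGroup G] [NormedSpace ℝ G]
    {K : Set F} (hK : IsCompact K) {f : E × F → G} (hf : ContDiff ℝ ∞ f)
    (hc : HasCompactSupport f) (hs : ∀ p : E × F, p.2 ∉ K → f p = 0) (x : E) :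
    HasFDerivAt (fun x : E => ∫ y, f (x, y))
      (∫ y, (fderiv ℝ f (x, y)).comp (ContinuousLinearMap.inl ℝ E F)) x := by
  have hf' : Continuous (fderiv ℝ f) := hf.continuous_fderiv (by simp)
  obtain ⟨C, hC⟩ := (hf'.bounded_above_of_compact_support (hc.fderiv ℝ))
  have hcont : Continuous fun p : E × F =>
      (fderiv ℝ f p).comp (ContinuousLinearMap.inl ℝ E F) := by fun_prop
  have hz : ∀ p : E × F, p.2 ∉ K →
      (fderiv ℝ f p).comp (ContinuousLinearMap.inl ℝ E F) = 0 := fun p hp => by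
    rw [fderiv_eq_zero_off hK hs p hp]; simp
  refine hasFDerivAt_integral_of_dominated_of_fderiv_le (s := univ)
    (bound := K.indicator fun _ => C) Filter.univ_mem
    (F' := fun x y => (fderiv ℝ f (x, y)).comp (ContinuousLinearMap.inl ℝ E F)) ?_ ?_ ?_ ?_ ?_ ?_
  · exact Filter.Eventually.of_forall fun x =>
      (integrable_slice hK hf.continuous hs x).aestronglyMeasurable
  · exact integrable_slice hK hf.continuous hs x
  · exact (integrable_slice hK hcont hz x).aestronglyMeasurable
  · refine Filter.Eventually.of_forall fun y x _ => ?_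
    by_cases hy : y ∈ K
    · rw [indicator_of_mem hy]
      refine (ContinuousLinearMap.opNorm_comp_le _ _).trans ?_
      calc _ ≤ ‖fderiv ℝ f (x, y)‖ * 1 := by
            gcongr; exact ContinuousLinearMap.norm_inl_le_one ℝ E F
        _ ≤ C := by simpa using hC (x, y)
    · rw [indicator_of_notMem hy, hz (x, y) hy]; simp
  · rw [integrable_indicator_iff hK.measurableSet]
    exact integrableOn_const hK.measure_ne_top
  · refine Filter.Eventually.of_forall fun y x _ => ?_
    have h1 : HasFDerivAt f (fderiv ℝ f (x, y)) (x, y) :=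
      (hf.differentiable (by simp) _).hasFDerivAt
    exact h1.comp x (hasFDerivAt_prodMk_left x y)

theorem contDiff_partialIntegral {K : Set F} (hK : IsCompact K) (n : ℕ) :
    ∀ {G : Type} [NormedAddCommGroup G] [NormedSpace ℝ G] {f : E × F → G},
      ContDiff ℝ ∞ f → HasCompactSupport f → (∀ p : E × F, p.2 ∉ K → f p = 0) →
      ContDiff ℝ n (fun x : E => ∫ y, f (x, y)) ∧
      ∀ C : ℝ, (∀ p : E × F, ‖iteratedFDeriv ℝ n f p‖ ≤ C) → ∀ x,
        ‖iteratedFDeriv ℝ n (fun x : E => ∫ y, f (x, y)) x‖ ≤ C * (volume : Measure F).real K := by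
  induction n with
  | zero =>
    intro G _ _ f hf hc hs
    have hd : Differentiable ℝ (fun x : E => ∫ y, f (x, y)) := fun x =>
      (hasFDerivAt_partialIntegral hK hf hc hs x).differentiableAt
    refine ⟨contDiff_zero.2 hd.continuous, fun C hC x => ?_⟩
    rw [norm_iteratedFDeriv_zero]
    have : ∫ y, f (x, y) = ∫ y in K, f (x, y) :=
      (setIntegral_eq_integral_of_forall_compl_eq_zero fun y hy => hs (x, y) hy).symm
    rw [this]
    exact norm_setIntegral_le_of_norm_le_const hK.measure_lt_top
      fun y _ => by simpa using hC (x, y)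
  | succ n ih =>
    intro G _ _ f hf hc hs
    have hD := hasFDerivAt_partialIntegral hK hf hc hs
    have hfd : fderiv ℝ (fun x : E => ∫ y, f (x, y)) =
        fun x => ∫ y, (fderiv ℝ f (x, y)).comp (ContinuousLinearMap.inl ℝ E F) :=
      funext fun x => (hD x).fderiv
    let L : (E × F →L[ℝ] G) →L[ℝ] (E →L[ℝ] G) :=
      (ContinuousLinearMap.compL ℝ E (E × F) G).flip (ContinuousLinearMap.inl ℝ E F)
    have hL : ‖L‖ ≤ 1 := L.opNorm_le_bound zero_le_one fun T => by
      refine (ContinuousLinearMap.opNorm_comp_le T _).trans ?_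
      rw [one_mul]
      exact mul_le_of_le_one_right (norm_nonneg _) (ContinuousLinearMap.norm_inl_le_one ℝ E F)
    have hf' : ContDiff ℝ ∞ (fderiv ℝ f) := hf.fderiv_right (by simp)
    have h := ih (f := fun p => L (fderiv ℝ f p)) (L.contDiff.comp hf')
      ((hc.fderiv ℝ).comp_left (map_zero L))
      (fun p hp => by rw [fderiv_eq_zero_off hK hs p hp, map_zero])
    refine ⟨?_, fun C hC x => ?_⟩
    · rw [Nat.cast_succ, contDiff_succ_iff_fderiv]
      refine ⟨fun x => (hD x).differentiableAt, by simp, ?_⟩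
      rw [hfd]; exact h.1
    · rw [← norm_iteratedFDeriv_fderiv, hfd]
      refine h.2 C (fun p => ?_) x
      have h2 := L.norm_iteratedFDeriv_comp_left (f := fderiv ℝ f) (x := p) (N := ∞) (n := n)
        hf'.contDiffAt (by exact_mod_cast le_top)
      refine h2.trans ?_
      rw [norm_iteratedFDeriv_fderiv]
      exact (mul_le_of_le_one_left (norm_nonneg _) hL).trans (hC p)

theorem eq_zero_of_snd_notMem {f : E × F → ℝ} {K : Set (E × F)} (hf : ∀ p, p ∉ K → f p = 0)
    (p : E × F) (hp : p.2 ∉ Prod.snd '' K) : f p = 0 :=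
  hf p fun h => hp ⟨p, h, rfl⟩

theorem partialIntegral_eq_zero {f : E × F → ℝ} {K : Set (E × F)} (hf : ∀ p, p ∉ K → f p = 0)
    (x : E) (hx : x ∉ Prod.fst '' K) : ∫ y, f (x, y) = 0 := by
  have : ∀ y, f (x, y) = 0 := fun y => hf _ fun h => hx ⟨(x, y), h, rfl⟩
  simp [this]

theorem norm_iteratedFDeriv_partialIntegral_le (K : Compacts (E × F)) (φ : 𝓓_{K}(E × F, ℝ))
    (i : ℕ) (x : E) :
    ‖iteratedFDeriv ℝ i (fun x : E => ∫ y, φ (x, y)) x‖ ≤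
      (volume : Measure F).real (Prod.snd '' (K : Set (E × F))) *
        ContDiffMapSupportedIn.seminorm ℝ (E × F) ℝ ⊤ K i φ := by
  rw [mul_comm]
  exact (contDiff_partialIntegral (K.isCompact.image continuous_snd) i φ.contDiff
    φ.hasCompactSupport (eq_zero_of_snd_notMem fun _ hp => φ.zero_on_compl hp)).2 _
    (fun p => ContDiffMapSupportedIn.norm_iteratedFDeriv_apply_le_seminorm_top ℝ) x

/-- Integration over the second variable on the Fréchet space of smooth functions supported in a
fixed compact set. -/
noncomputable def partialIntegralSupportedIn (K : Compacts (E × F)) :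
    𝓓_{K}(E × F, ℝ) →L[ℝ] 𝓓_{K.map Prod.fst continuous_fst}(E, ℝ) :=
  mkSupportedIn (fun (φ : 𝓓_{K}(E × F, ℝ)) (x : E) => ∫ y, φ (x, y))
    (fun φ ψ x => integral_add
      (integrable_slice (K.isCompact.image continuous_snd) φ.continuous
        (eq_zero_of_snd_notMem fun _ hp => φ.zero_on_compl hp) x)
      (integrable_slice (K.isCompact.image continuous_snd) ψ.continuous
        (eq_zero_of_snd_notMem fun _ hp => ψ.zero_on_compl hp) x))
    (fun c φ x => integral_const_mul c fun y => φ (x, y))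
    (fun φ => contDiff_infty.2 fun n =>
      (contDiff_partialIntegral (K.isCompact.image continuous_snd) n φ.contDiff φ.hasCompactSupport
        (eq_zero_of_snd_notMem fun _ hp => φ.zero_on_compl hp)).1)
    (fun φ x hx => partialIntegral_eq_zero (fun _ hp => φ.zero_on_compl hp) x hx)
    (fun i => ⟨_, measureReal_nonneg, fun φ x =>
      norm_iteratedFDeriv_partialIntegral_le K φ i x⟩)

/-- Integration of a test function on `E × F` over the second variable, as a continuous linear
map `𝓓(E × F) → 𝓓(E)`, `φ ↦ (x ↦ ∫ φ(x, y) dy)`. -/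
noncomputable def partialIntegral :
    𝓓((⊤ : Opens (E × F)), ℝ) →L[ℝ] 𝓓((⊤ : Opens E), ℝ) :=
  TestFunction.limitCLM ℝ
    (fun φ => ⟨fun x => ∫ y, φ (x, y),
      contDiff_infty.2 fun n =>
        (contDiff_partialIntegral (φ.hasCompactSupport.isCompact.image continuous_snd) n φ.contDiff
          φ.hasCompactSupport
          (eq_zero_of_snd_notMem fun _ hp => image_eq_zero_of_notMem_tsupport hp)).1,
      HasCompactSupport.intro (φ.hasCompactSupport.isCompact.image continuous_fst)
        (partialIntegral_eq_zero fun _ hp => image_eq_zero_of_notMem_tsupport hp),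
      fun _ _ => trivial⟩)
    (fun K _ => TestFunction.ofSupportedInCLM ℝ (fun _ _ => trivial) ∘L
      partialIntegralSupportedIn K)
    (fun _ _ _ => rfl)

theorem partialIntegral_apply (φ : 𝓓((⊤ : Opens (E × F)), ℝ)) (x : E) :
    partialIntegral φ x = ∫ y, φ (x, y) := rfl

end PartialIntegral

section CompEquiv

variable {E F : Type} [NormedAddCommGroup E] [NormedSpace ℝ E]
  [NormedAddCommGroup F] [NormedSpace ℝ F]

theorem norm_iteratedFDeriv_compEquiv_le (e : E ≃L[ℝ] F) (K : Compacts F) (φ : 𝓓_{K}(F, ℝ))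
    (i : ℕ) (x : E) :
    ‖iteratedFDeriv ℝ i (fun x : E => φ (e x)) x‖ ≤
      ‖(e : E →L[ℝ] F)‖ ^ i * ContDiffMapSupportedIn.seminorm ℝ F ℝ ⊤ K i φ := by
  have h : iteratedFDeriv ℝ i (fun x : E => φ (e x)) x = _ :=
    (e : E →L[ℝ] F).iteratedFDeriv_comp_right (n := ∞) φ.contDiff x (i := i)
      (by exact_mod_cast le_top)
  rw [h]
  refine (ContinuousMultilinearMap.norm_compContinuousLinearMap_le _ _).trans ?_
  rw [Finset.prod_const, Finset.card_univ, Fintype.card_fin, mul_comm]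
  gcongr
  exact ContDiffMapSupportedIn.norm_iteratedFDeriv_apply_le_seminorm_top ℝ

/-- Linear change of variables in smooth functions supported in a fixed compact set. -/
noncomputable def compEquivSupportedIn (e : E ≃L[ℝ] F) (K : Compacts F) :
    𝓓_{K}(F, ℝ) →L[ℝ] 𝓓_{K.map e.symm e.symm.continuous}(E, ℝ) :=
  mkSupportedIn (fun (φ : 𝓓_{K}(F, ℝ)) (x : E) => φ (e x))
    (fun _ _ _ => rfl) (fun _ _ _ => rfl)
    (fun φ => φ.contDiff.comp e.contDiff)
    (fun φ x hx => φ.zero_on_compl fun h => hx ⟨e x, h, e.symm_apply_apply x⟩)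
    (fun i => ⟨_, by positivity, fun φ x => norm_iteratedFDeriv_compEquiv_le e K φ i x⟩)

/-- Linear change of variables in test functions: `φ ↦ φ ∘ e`, as a continuous linear map
`𝓓(F) → 𝓓(E)`. -/
noncomputable def compEquiv (e : E ≃L[ℝ] F) :
    𝓓((⊤ : Opens F), ℝ) →L[ℝ] 𝓓((⊤ : Opens E), ℝ) :=
  TestFunction.limitCLM ℝ
    (fun φ => ⟨fun x => φ (e x), φ.contDiff.comp e.contDiff,
      φ.hasCompactSupport.comp_homeomorph e.toHomeomorph, fun _ _ => trivial⟩)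
    (fun K _ => TestFunction.ofSupportedInCLM ℝ (fun _ _ => trivial) ∘L compEquivSupportedIn e K)
    (fun _ _ _ => rfl)

theorem compEquiv_apply (e : E ≃L[ℝ] F) (φ : 𝓓((⊤ : Opens F), ℝ)) (x : E) :
    compEquiv e φ x = φ (e x) := rfl

end CompEquiv

section Distributions

/-- `𝓓'(ℝᵈ)`: complex valued Schwartz distributions on `ℝᵈ`. -/
abbrev Distr (d : ℕ) := 𝓓'((⊤ : Opens (Fin d → ℝ)), ℂ)

/-- `𝓓'(ℝᵈ × ℝᵈ)`: complex valued Schwartz distributions on `ℝᵈ × ℝᵈ`. -/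
abbrev Distr₂ (d : ℕ) := 𝓓'((⊤ : Opens ((Fin d → ℝ) × (Fin d → ℝ))), ℂ)

variable {d : ℕ}

/-- The linear automorphism of `ℝᵈ` given by an invertible matrix. -/
noncomputable def matEquiv (b : GL (Fin d) ℝ) : (Fin d → ℝ) ≃L[ℝ] (Fin d → ℝ) :=
  ContinuousLinearEquiv.equivOfInverse
    (Matrix.mulVecLin (b : Matrix (Fin d) (Fin d) ℝ)).toContinuousLinearMap
    (Matrix.mulVecLin ((b⁻¹ : GL (Fin d) ℝ) : Matrix (Fin d) (Fin d) ℝ)).toContinuousLinearMap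
    (fun x => by simp [Matrix.mulVec_mulVec]) (fun x => by simp [Matrix.mulVec_mulVec])

/-- The linear automorphism `(u, v) ↦ (b⁻¹ (u - v), c⁻¹ v)` of `ℝᵈ × ℝᵈ`, which is the inverse of
`(x, y) ↦ (b x + c y, c y)`. -/
noncomputable def sumCoords (b c : GL (Fin d) ℝ) :
    ((Fin d → ℝ) × (Fin d → ℝ)) ≃L[ℝ] ((Fin d → ℝ) × (Fin d → ℝ)) :=
  ContinuousLinearEquiv.equivOfInverse
    (((matEquiv b⁻¹ : (Fin d → ℝ) →L[ℝ] (Fin d → ℝ)) ∘L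
        (ContinuousLinearMap.fst ℝ _ _ - ContinuousLinearMap.snd ℝ _ _)).prod
      ((matEquiv c⁻¹ : (Fin d → ℝ) →L[ℝ] (Fin d → ℝ)) ∘L ContinuousLinearMap.snd ℝ _ _))
    (((matEquiv b : (Fin d → ℝ) →L[ℝ] (Fin d → ℝ)) ∘L ContinuousLinearMap.fst ℝ _ _ +
        (matEquiv c : (Fin d → ℝ) →L[ℝ] (Fin d → ℝ)) ∘L ContinuousLinearMap.snd ℝ _ _).prod
      ((matEquiv c : (Fin d → ℝ) →L[ℝ] (Fin d → ℝ)) ∘L ContinuousLinearMap.snd ℝ _ _))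
    (fun p => by simp [matEquiv, Matrix.mulVec_mulVec, Matrix.mulVec_sub])
    (fun p => by simp [matEquiv, Matrix.mulVec_mulVec, Matrix.mulVec_add])

theorem sumCoords_apply (b c : GL (Fin d) ℝ) (u v : Fin d → ℝ) :
    sumCoords b c (u, v) =
      (((b⁻¹ : GL (Fin d) ℝ) : Matrix (Fin d) (Fin d) ℝ).mulVec (u - v),
        ((c⁻¹ : GL (Fin d) ℝ) : Matrix (Fin d) (Fin d) ℝ).mulVec v) := rfl

/-- The distribution `f(b x + c y)` on `ℝᵈ × ℝᵈ`: its value at a test function `φ` is the value of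
`f` at `u ↦ |det b|⁻¹ |det c|⁻¹ ∫ φ(b⁻¹ (u - v), c⁻¹ v) dv`. -/
noncomputable def compSum (f : Distr d) (b c : GL (Fin d) ℝ) : Distr₂ d :=
  ((|(b : Matrix (Fin d) (Fin d) ℝ).det| * |(c : Matrix (Fin d) (Fin d) ℝ).det|)⁻¹ : ℝ) •
    (f ∘L partialIntegral ∘L compEquiv (sumCoords b c))

/-- The distribution `P(x)·1(y)` on `ℝᵈ × ℝᵈ`: its value at a test function `φ` is the value of `P`
at `x ↦ ∫ φ(x, y) dy`. -/
noncomputable def tensorOne (P : Distr d) : Distr₂ d :=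
  P ∘L partialIntegral

/-- The distribution `1(x)·Q(y)` on `ℝᵈ × ℝᵈ`: its value at a test function `φ` is the value of `Q`
at `y ↦ ∫ φ(x, y) dx`. -/
noncomputable def oneTensor (Q : Distr d) : Distr₂ d :=
  Q ∘L partialIntegral ∘L compEquiv (ContinuousLinearEquiv.prodComm ℝ (Fin d → ℝ) (Fin d → ℝ))

/-- The distribution `T` on `ℝᵈ` is (integration against) a polynomial function with complex
coefficients of total degree at most `n`; for `n < 0` this means that `T` is zero. -/
def IsPolynomialOfDegreeLE (T : Distr d) (n : ℤ) : Prop :=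
  ∃ p : MvPolynomial (Fin d) ℂ, (∀ s ∈ p.support, (s.degree : ℤ) ≤ n) ∧
    ∀ φ : 𝓓((⊤ : Opens (Fin d → ℝ)), ℝ),
      T φ = ∫ x, (φ x : ℂ) * MvPolynomial.eval (fun i => (x i : ℂ)) p

end Distributions

end DistEq

/-! Everything is done by duality, on test functions. A direction `w` with `b i w.1 + c i w.2 = 0`
is one along which `f i (b i x + c i y)` is constant, so this distribution kills every derivative in
that direction (`compSum_dirDeriv`). The first component of such a `w` can be prescribed freely,
since invertibility of `c i` determines the second; likewise the second, since `b i` is invertible.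
Testing the equation on an `m`-fold derivative with one such direction for each `i` removes all `f
i` (`elimination`) and leaves only `P` and `Q`. One more derivative, along `(v₀, 0)` or `(0, v₀)`,
removes `Q` or `P`; it is not needed when that term is already zero. Hence `P` and `Q` kill all
derivatives of order `m + 1`, respectively `m`.

It remains to see that a functional killing all derivatives of order `n` is a polynomial of degree
less than `n` (`exists_polyFunctional_eq`). For `n = 1` it is a multiple of the integral
(`constantOfGradientZero_pi`), by induction on the dimension: a test function on `E × ℝ` whose
integrals over the lines `{x} × ℝ` all vanish has a compactly supported primitive. For larger `n`,
the top-order derivatives of the functional are constants; subtracting the homogeneous polynomial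
with the same derivatives lowers the order. -/

namespace DistEq

/-! ### Directional derivatives of test functions -/

section LineDerivatives

variable {E F : Type} [NormedAddCommGroup E] [NormedSpace ℝ E]
  [NormedAddCommGroup F] [NormedSpace ℝ F]

/-- The derivative of a test function in the direction `v`. -/
noncomputable def dirDeriv (v : E) : Module.End ℝ 𝓓((⊤ : Opens E), ℝ) :=
  (TestFunction.lineDerivCLM ℝ v : 𝓓((⊤ : Opens E), ℝ) →L[ℝ] 𝓓((⊤ : Opens E), ℝ))

theorem differentiable_testFunction (φ : 𝓓((⊤ : Opens E), ℝ)) : Differentiable ℝ φ :=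
  φ.contDiff.differentiable (by simp)

theorem dirDeriv_apply (v : E) (φ : 𝓓((⊤ : Opens E), ℝ)) (x : E) :
    dirDeriv v φ x = fderiv ℝ φ x v := by
  have h : dirDeriv v φ x = lineDeriv ℝ φ x v :=
    TestFunction.lineDerivCLM_apply_of_le (k := ⊤) (n := ⊤) (by simp)
  rw [h, (differentiable_testFunction φ x).lineDeriv_eq_fderiv]

theorem dirDeriv_zero : dirDeriv (0 : E) = 0 := by
  ext φ x
  rw [dirDeriv_apply]
  simp

theorem dirDeriv_comm (v w : E) (φ : 𝓓((⊤ : Opens E), ℝ)) :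
    dirDeriv v (dirDeriv w φ) = dirDeriv w (dirDeriv v φ) := by
  have key : ∀ v w : E, ∀ x,
      dirDeriv v (dirDeriv w φ) x = fderiv ℝ (fderiv ℝ φ) x v w := fun v w x => by
    rw [dirDeriv_apply]
    have hd : DifferentiableAt ℝ (fderiv ℝ φ) x :=
      ((φ.contDiff.fderiv_right (m := ∞) (by simp)).differentiable (by simp)) x
    have : ⇑(dirDeriv w φ) = fun y => fderiv ℝ φ y w := funext fun y => dirDeriv_apply w φ y
    rw [this, fderiv_clm_apply hd (differentiableAt_const w)]
    simp
  ext x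
  rw [key, key]
  exact (φ.contDiff.contDiffAt.isSymmSndFDerivAt (n := ∞)
    (by simpa using WithTop.coe_le_coe.2 (le_top (a := (2 : ℕ∞))))).eq v w

theorem commute_dirDeriv (v w : E) : Commute (dirDeriv v) (dirDeriv w) :=
  LinearMap.ext fun φ => dirDeriv_comm v w φ

/-- The iterated derivative of a test function in the directions given by a list. -/
noncomputable def iterDirDeriv (l : List E) : Module.End ℝ 𝓓((⊤ : Opens E), ℝ) :=
  (l.map dirDeriv).prod

theorem iterDirDeriv_nil : iterDirDeriv ([] : List E) = 1 := rfl

theorem iterDirDeriv_cons (v : E) (l : List E) :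
    iterDirDeriv (v :: l) = dirDeriv v * iterDirDeriv l := by
  simp [iterDirDeriv]

theorem iterDirDeriv_append (l l' : List E) :
    iterDirDeriv (l ++ l') = iterDirDeriv l * iterDirDeriv l' := by
  simp [iterDirDeriv]

theorem iterDirDeriv_perm {l l' : List E} (h : l.Perm l') : iterDirDeriv l = iterDirDeriv l' := by
  refine (h.map dirDeriv).prod_eq' (List.pairwise_map.2 ?_)
  exact List.pairwise_of_forall fun v w => commute_dirDeriv v w

/-- Directional derivatives commute, so any listed direction can be made the outermost one. A
functional that kills derivatives along a single `v ∈ l` therefore kills the whole iterated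
derivative. -/
theorem exists_iterDirDeriv_eq {l : List E} {v : E} (hv : v ∈ l) (φ : 𝓓((⊤ : Opens E), ℝ)) :
    ∃ ψ, iterDirDeriv l φ = dirDeriv v ψ := by
  classical
  refine ⟨iterDirDeriv (l.erase v) φ, ?_⟩
  rw [iterDirDeriv_perm (List.perm_cons_erase hv), iterDirDeriv_cons]
  rfl

theorem compEquiv_dirDeriv (e : E ≃L[ℝ] F) (v : F) (φ : 𝓓((⊤ : Opens F), ℝ)) :
    compEquiv e (dirDeriv v φ) = dirDeriv (e.symm v) (compEquiv e φ) := by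
  ext x
  rw [compEquiv_apply, dirDeriv_apply, dirDeriv_apply]
  have : ⇑(compEquiv e φ) = φ ∘ e := rfl
  rw [this, e.comp_right_fderiv]
  simp

theorem compEquiv_iterDirDeriv (e : E ≃L[ℝ] F) (l : List F) (φ : 𝓓((⊤ : Opens F), ℝ)) :
    compEquiv e (iterDirDeriv l φ) = iterDirDeriv (l.map e.symm) (compEquiv e φ) := by
  induction l with
  | nil => rfl
  | cons v l ih =>
    rw [List.map_cons, iterDirDeriv_cons, iterDirDeriv_cons, Module.End.mul_apply,
      Module.End.mul_apply, compEquiv_dirDeriv, ih]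

end LineDerivatives

/-! ### Derivatives and partial integration -/

section Integrals

variable {E F : Type} [NormedAddCommGroup E] [NormedSpace ℝ E]
  [NormedAddCommGroup F] [NormedSpace ℝ F] [MeasureSpace F] [BorelSpace F]

theorem integrable_testFunction [IsFiniteMeasureOnCompacts (volume : Measure F)]
    (φ : 𝓓((⊤ : Opens F), ℝ)) : Integrable (φ : F → ℝ) :=
  φ.continuous.integrable_of_hasCompactSupport φ.hasCompactSupport

variable [FiniteDimensional ℝ F] [(volume : Measure F).IsAddHaarMeasure]

theorem integral_fderiv_eq_zero {g : F → ℝ} (hg : ContDiff ℝ 1 g) (hc : HasCompactSupport g)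
    (v : F) : ∫ x, fderiv ℝ g x v = 0 := by
  have hi : Integrable fun x => fderiv ℝ g x v :=
    ((hg.continuous_fderiv (by simp)).clm_apply continuous_const).integrable_of_hasCompactSupport
      ((hc.fderiv ℝ).comp_left (g := fun L : F →L[ℝ] ℝ => L v) rfl)
  have h := integral_mul_fderiv_eq_neg_fderiv_mul_of_integrable (μ := (volume : Measure F))
    (f := fun _ => (1 : ℝ)) (g := g) (v := v) (by simp) (by simpa using hi)
    (by simpa using hg.continuous.integrable_of_hasCompactSupport hc)
    (fun _ _ => differentiableAt_const _) (fun _ _ => hg.differentiable (by simp) _)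
  simpa using h

/-- The component of `w` along `E` passes under the integral; the component along `F` contributes
the integral of a derivative of a compactly supported function, which is zero. -/
theorem partialIntegral_dirDeriv (w : E × F) (Φ : 𝓓((⊤ : Opens (E × F)), ℝ)) :
    partialIntegral (dirDeriv w Φ) = dirDeriv w.1 (partialIntegral Φ) := by
  have hK := Φ.hasCompactSupport.isCompact.image continuous_snd
  have hs : ∀ p : E × F, p.2 ∉ Prod.snd '' tsupport Φ → Φ p = 0 :=
    eq_zero_of_snd_notMem fun _ hp => image_eq_zero_of_notMem_tsupport hp
  have hf' : Continuous (fderiv ℝ Φ) := Φ.contDiff.continuous_fderiv (by simp)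
  ext x
  rw [dirDeriv_apply, partialIntegral_apply]
  have hD := hasFDerivAt_partialIntegral hK Φ.contDiff Φ.hasCompactSupport hs x
  have h1 : fderiv ℝ (partialIntegral Φ) x = _ := hD.fderiv
  have hint : Integrable fun y => (fderiv ℝ Φ (x, y)).comp (ContinuousLinearMap.inl ℝ E F) :=
    integrable_slice hK (f := fun p => (fderiv ℝ Φ p).comp (ContinuousLinearMap.inl ℝ E F))
      (by fun_prop) (fun p hp => by rw [fderiv_eq_zero_off hK hs p hp]; simp) x
  have hint2 : ∀ w : E × F, Integrable fun y => fderiv ℝ Φ (x, y) w := fun w =>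
    integrable_slice hK (f := fun p => fderiv ℝ Φ p w)
      (by fun_prop) (fun p hp => by rw [fderiv_eq_zero_off hK hs p hp]; simp) x
  rw [h1, ContinuousLinearMap.integral_apply hint]
  have hsplit : ∀ y, dirDeriv w Φ (x, y) = fderiv ℝ Φ (x, y) (w.1, 0) +
      fderiv ℝ Φ (x, y) (0, w.2) := fun y => by
    rw [dirDeriv_apply, ← map_add]; simp
  simp_rw [hsplit]
  rw [integral_add (hint2 _) (hint2 _)]
  have hzero : ∫ y, fderiv ℝ Φ (x, y) (0, w.2) = 0 := by
    have hslice : ContDiff ℝ 1 fun y => Φ (x, y) :=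
      (Φ.contDiff.of_le (by simp)).comp (contDiff_const.prodMk contDiff_id)
    rw [← integral_fderiv_eq_zero hslice (HasCompactSupport.intro hK fun y hy => hs (x, y) hy) w.2]
    refine integral_congr_ae (.of_forall fun y => ?_)
    have h2 := (differentiable_testFunction Φ (x, y)).hasFDerivAt.comp y
      (hasFDerivAt_prodMk_right x y)
    have h3 : fderiv ℝ (fun y => Φ (x, y)) y = _ := h2.fderiv
    simp [h3]
  rw [hzero, add_zero]
  rfl

theorem partialIntegral_iterDirDeriv (l : List (E × F)) (Φ : 𝓓((⊤ : Opens (E × F)), ℝ)) :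
    partialIntegral (iterDirDeriv l Φ) = iterDirDeriv (l.map Prod.fst) (partialIntegral Φ) := by
  induction l with
  | nil => rfl
  | cons v l ih =>
    rw [List.map_cons, iterDirDeriv_cons, iterDirDeriv_cons, Module.End.mul_apply,
      Module.End.mul_apply, partialIntegral_dirDeriv, ih]

end Integrals

/-! ### Tensor products as a section of partial integration -/

section Tensor

variable {E F : Type} [NormedAddCommGroup E] [NormedSpace ℝ E]
  [NormedAddCommGroup F] [NormedSpace ℝ F]

/-- The tensor product `(x, y) ↦ φ x * ρ y` of two test functions. -/
noncomputable def tensor (ρ : 𝓓((⊤ : Opens F), ℝ)) :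
    𝓓((⊤ : Opens E), ℝ) →ₗ[ℝ] 𝓓((⊤ : Opens (E × F)), ℝ) where
  toFun φ := ⟨fun p => φ p.1 * ρ p.2,
    (φ.contDiff.comp contDiff_fst).mul (ρ.contDiff.comp contDiff_snd),
    HasCompactSupport.intro (φ.hasCompactSupport.isCompact.prod ρ.hasCompactSupport.isCompact)
      fun p hp => by
        by_cases h : p.1 ∈ tsupport φ
        · have h2 : p.2 ∉ tsupport ρ := fun h' => hp ⟨h, h'⟩
          simp [image_eq_zero_of_notMem_tsupport h2]
        · simp [image_eq_zero_of_notMem_tsupport h],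
    fun _ _ => trivial⟩
  map_add' φ ψ := TestFunction.ext fun p => add_mul (φ p.1) (ψ p.1) (ρ p.2)
  map_smul' c φ := TestFunction.ext fun p => mul_assoc c (φ p.1) (ρ p.2)

theorem tensor_apply (ρ : 𝓓((⊤ : Opens F), ℝ)) (φ : 𝓓((⊤ : Opens E), ℝ)) (p : E × F) :
    tensor ρ φ p = φ p.1 * ρ p.2 := rfl

theorem dirDeriv_tensor (ρ : 𝓓((⊤ : Opens F), ℝ)) (φ : 𝓓((⊤ : Opens E), ℝ)) (v : E) :
    dirDeriv (v, 0) (tensor ρ φ) = tensor ρ (dirDeriv v φ) := by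
  ext p
  rw [dirDeriv_apply, tensor_apply, dirDeriv_apply]
  have h1 : HasFDerivAt (fun p : E × F => φ p.1) _ p :=
    (differentiable_testFunction φ p.1).hasFDerivAt.comp p hasFDerivAt_fst
  have h2 : HasFDerivAt (fun p : E × F => ρ p.2) _ p :=
    (differentiable_testFunction ρ p.2).hasFDerivAt.comp p hasFDerivAt_snd
  have h3 : fderiv ℝ (tensor ρ φ) p = _ := (h1.mul h2).fderiv
  rw [h3]
  simp [mul_comm]

/-- This right inverse serves twice: it makes partial integration surjective, so that `P` and `Q`
can be tested on arbitrary functions, and it drives the induction on the dimension. -/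
theorem partialIntegral_tensor [MeasureSpace F] [BorelSpace F]
    [IsFiniteMeasureOnCompacts (volume : Measure F)] {ρ : 𝓓((⊤ : Opens F), ℝ)}
    (hρ : ∫ y, ρ y = 1) (φ : 𝓓((⊤ : Opens E), ℝ)) : partialIntegral (tensor ρ φ) = φ := by
  ext x
  rw [partialIntegral_apply]
  simp_rw [tensor_apply]
  rw [integral_const_mul, hρ, mul_one]

theorem exists_testFunction_integral_eq_one (F : Type) [NormedAddCommGroup F] [NormedSpace ℝ F]
    [MeasureSpace F] [BorelSpace F] [FiniteDimensional ℝ F]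
    [(volume : Measure F).IsAddHaarMeasure] :
    ∃ ρ : 𝓓((⊤ : Opens F), ℝ), ∫ y, ρ y = 1 := by
  let β : ContDiffBump (0 : F) := ⟨1, 2, one_pos, one_lt_two⟩
  exact ⟨⟨β.normed volume, β.contDiff_normed, β.hasCompactSupport_normed, fun _ _ => trivial⟩,
    β.integral_normed⟩

end Tensor

/-! ### Eliminating the `f i` from the equation -/

section Elimination

variable {d m : ℕ}

/-- In the coordinates `(u, v) = (b x + c y, c y)` the direction `w` has zero `u`-component, so the
derivative is taken purely in the variable `v` that is integrated out. -/
theorem compSum_dirDeriv (f : Distr d) (b c : GL (Fin d) ℝ) (w : (Fin d → ℝ) × (Fin d → ℝ))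
    (hw : matEquiv b w.1 + matEquiv c w.2 = 0)
    (Φ : 𝓓((⊤ : Opens ((Fin d → ℝ) × (Fin d → ℝ))), ℝ)) :
    compSum f b c (dirDeriv w Φ) = 0 := by
  have h : partialIntegral (compEquiv (sumCoords b c) (dirDeriv w Φ)) = 0 := by
    rw [compEquiv_dirDeriv, partialIntegral_dirDeriv]
    have : ((sumCoords b c).symm w).1 = 0 := hw
    rw [this, dirDeriv_zero]
    rfl
  change (_ : ℝ) • f (partialIntegral (compEquiv (sumCoords b c) (dirDeriv w Φ))) = 0
  rw [h, map_zero, smul_zero]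

theorem matEquiv_mul_apply (a b : GL (Fin d) ℝ) (x : Fin d → ℝ) :
    matEquiv (a * b) x = matEquiv a (matEquiv b x) := by
  simp [matEquiv, Matrix.mulVec_mulVec]

/-- Derivatives along directions annihilating the `f i` eliminate them from the equation. -/
theorem elimination {f : Fin m → Distr d} {P Q : Distr d} {b c : Fin m → GL (Fin d) ℝ}
    (heq : ∑ i, compSum (f i) (b i) (c i) = tensorOne P + oneTensor Q)
    (l : List ((Fin d → ℝ) × (Fin d → ℝ)))
    (hl : ∀ i, ∃ w ∈ l, matEquiv (b i) w.1 + matEquiv (c i) w.2 = 0)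
    (Φ : 𝓓((⊤ : Opens ((Fin d → ℝ) × (Fin d → ℝ))), ℝ)) :
    P (iterDirDeriv (l.map Prod.fst) (partialIntegral Φ)) +
      Q (iterDirDeriv (l.map Prod.snd) (partialIntegral
        (compEquiv (ContinuousLinearEquiv.prodComm ℝ (Fin d → ℝ) (Fin d → ℝ)) Φ))) = 0 := by
  have h := congrArg (fun T : Distr₂ d => T (iterDirDeriv l Φ)) heq
  have h0 : (∑ i, compSum (f i) (b i) (c i)) (iterDirDeriv l Φ) = 0 := by
    have : (∑ i, compSum (f i) (b i) (c i)) (iterDirDeriv l Φ) =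
        ∑ i, compSum (f i) (b i) (c i) (iterDirDeriv l Φ) := by
      induction (Finset.univ : Finset (Fin m)) using Finset.cons_induction with
      | empty => rfl
      | cons i s hi ih => rw [Finset.sum_cons, Finset.sum_cons, ← ih]; rfl
    rw [this]
    -- Each summand is killed by its own direction in `l`, moved to the outermost place.
    refine Finset.sum_eq_zero fun i _ => ?_
    obtain ⟨w, hw, hw0⟩ := hl i
    obtain ⟨ψ, hψ⟩ := exists_iterDirDeriv_eq hw Φ
    rw [hψ, compSum_dirDeriv _ _ _ _ hw0]
  have h1 : tensorOne P (iterDirDeriv l Φ) = P (partialIntegral (iterDirDeriv l Φ)) := rfl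
  have h2 : oneTensor Q (iterDirDeriv l Φ) = Q (partialIntegral
        (compEquiv (ContinuousLinearEquiv.prodComm ℝ (Fin d → ℝ) (Fin d → ℝ))
          (iterDirDeriv l Φ))) := rfl
  have h3 : (tensorOne P + oneTensor Q) (iterDirDeriv l Φ) =
    tensorOne P (iterDirDeriv l Φ) + oneTensor Q (iterDirDeriv l Φ) := rfl
  simp only [h0, h3, h1, h2] at h
  rw [partialIntegral_iterDirDeriv, compEquiv_iterDirDeriv, partialIntegral_iterDirDeriv,
    List.map_map] at h
  exact h.symm

/-- The list of directions `(v j, -(c j)⁻¹ (b j) (v j))`. -/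
theorem exists_directions_fst (b c : Fin m → GL (Fin d) ℝ) {v : List (Fin d → ℝ)}
    (hv : v.length = m) : ∃ l : List ((Fin d → ℝ) × (Fin d → ℝ)), l.map Prod.fst = v ∧
      ∀ i, ∃ w ∈ l, matEquiv (b i) w.1 + matEquiv (c i) w.2 = 0 := by
  subst hv
  refine ⟨List.ofFn fun i => (v.get i, -matEquiv (c i)⁻¹ (matEquiv (b i) (v.get i))), ?_,
    fun i => ⟨_, List.mem_ofFn.2 ⟨i, rfl⟩, ?_⟩⟩
  · rw [List.map_ofFn]
    exact List.ofFn_get v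
  · simp [← matEquiv_mul_apply]

/-- The condition on `w` is symmetric under exchanging `b` with `c` and the two components of `w`.
-/
theorem exists_directions_snd (b c : Fin m → GL (Fin d) ℝ) {v : List (Fin d → ℝ)}
    (hv : v.length = m) : ∃ l : List ((Fin d → ℝ) × (Fin d → ℝ)), l.map Prod.snd = v ∧
      ∀ i, ∃ w ∈ l, matEquiv (b i) w.1 + matEquiv (c i) w.2 = 0 := by
  obtain ⟨l, hl, h⟩ := exists_directions_fst c b hv
  refine ⟨l.map Prod.swap, by rw [List.map_map]; exact hl, fun i => ?_⟩
  obtain ⟨w, hw, hw0⟩ := h i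
  exact ⟨w.swap, List.mem_map_of_mem hw, (add_comm _ _).trans hw0⟩

theorem exists_partialIntegral_eq (φ : 𝓓((⊤ : Opens (Fin d → ℝ)), ℝ)) :
    ∃ Φ : 𝓓((⊤ : Opens ((Fin d → ℝ) × (Fin d → ℝ))), ℝ), partialIntegral Φ = φ := by
  obtain ⟨ρ, hρ⟩ := exists_testFunction_integral_eq_one (Fin d → ℝ)
  exact ⟨tensor ρ φ, partialIntegral_tensor hρ φ⟩

variable {f : Fin m → Distr d} {P Q : Distr d} {b c : Fin m → GL (Fin d) ℝ}

/-- The `m` eliminating directions are joined by `(v₀, 0)`, whose zero second component makes the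
operator acting in front of `Q` vanish. This is what costs the extra order. -/
theorem fst_annihilates (heq : ∑ i, compSum (f i) (b i) (c i) = tensorOne P + oneTensor Q)
    {v : List (Fin d → ℝ)} (hv : v.length = m + 1) (φ : 𝓓((⊤ : Opens (Fin d → ℝ)), ℝ)) :
    P (iterDirDeriv v φ) = 0 := by
  obtain ⟨Φ, rfl⟩ := exists_partialIntegral_eq φ
  obtain ⟨v₀, v, rfl⟩ := List.exists_cons_of_length_eq_add_one hv
  obtain ⟨l, rfl, h⟩ := exists_directions_fst b c (v := v) (by simpa using hv)
  have := elimination heq ((v₀, 0) :: l)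
    (fun i => (h i).imp fun w hw => ⟨List.mem_cons_of_mem _ hw.1, hw.2⟩) Φ
  rw [List.map_cons, List.map_cons, iterDirDeriv_cons (0 : Fin d → ℝ), dirDeriv_zero, zero_mul,
    LinearMap.zero_apply, map_zero, add_zero] at this
  exact this

theorem fst_annihilates_of_snd_eq_zero
    (heq : ∑ i, compSum (f i) (b i) (c i) = tensorOne P + oneTensor Q) (hQ : Q = 0)
    {v : List (Fin d → ℝ)} (hv : v.length = m) (φ : 𝓓((⊤ : Opens (Fin d → ℝ)), ℝ)) :
    P (iterDirDeriv v φ) = 0 := by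
  obtain ⟨Φ, rfl⟩ := exists_partialIntegral_eq φ
  obtain ⟨l, rfl, h⟩ := exists_directions_fst b c hv
  have := elimination heq l h Φ
  subst hQ
  exact (add_zero _).symm.trans this

theorem exists_partialIntegral_swap_eq (φ : 𝓓((⊤ : Opens (Fin d → ℝ)), ℝ)) :
    ∃ Φ : 𝓓((⊤ : Opens ((Fin d → ℝ) × (Fin d → ℝ))), ℝ), partialIntegral
      (compEquiv (ContinuousLinearEquiv.prodComm ℝ (Fin d → ℝ) (Fin d → ℝ)) Φ) = φ := by
  obtain ⟨Φ, hΦ⟩ := exists_partialIntegral_eq φ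
  -- Swapping the variables twice gives back `Φ` definitionally.
  exact ⟨compEquiv (ContinuousLinearEquiv.prodComm ℝ (Fin d → ℝ) (Fin d → ℝ)) Φ, hΦ⟩

theorem snd_annihilates (heq : ∑ i, compSum (f i) (b i) (c i) = tensorOne P + oneTensor Q)
    {v : List (Fin d → ℝ)} (hv : v.length = m + 1) (φ : 𝓓((⊤ : Opens (Fin d → ℝ)), ℝ)) :
    Q (iterDirDeriv v φ) = 0 := by
  obtain ⟨Φ, rfl⟩ := exists_partialIntegral_swap_eq φ
  obtain ⟨v₀, v, rfl⟩ := List.exists_cons_of_length_eq_add_one hv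
  obtain ⟨l, rfl, h⟩ := exists_directions_snd b c (v := v) (by simpa using hv)
  have := elimination heq ((0, v₀) :: l)
    (fun i => (h i).imp fun w hw => ⟨List.mem_cons_of_mem _ hw.1, hw.2⟩) Φ
  rw [List.map_cons, List.map_cons, iterDirDeriv_cons (0 : Fin d → ℝ), dirDeriv_zero, zero_mul,
    LinearMap.zero_apply, map_zero, zero_add] at this
  exact this

theorem snd_annihilates_of_fst_eq_zero
    (heq : ∑ i, compSum (f i) (b i) (c i) = tensorOne P + oneTensor Q) (hP : P = 0)
    {v : List (Fin d → ℝ)} (hv : v.length = m) (φ : 𝓓((⊤ : Opens (Fin d → ℝ)), ℝ)) :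
    Q (iterDirDeriv v φ) = 0 := by
  obtain ⟨Φ, rfl⟩ := exists_partialIntegral_swap_eq φ
  obtain ⟨l, rfl, h⟩ := exists_directions_snd b c hv
  have := elimination heq l h Φ
  subst hP
  exact (zero_add _).symm.trans this

end Elimination

/-! ### Compactly supported primitives in one real variable -/

section Primitive

variable {E : Type} [NormedAddCommGroup E] [NormedSpace ℝ E]

/-- The primitive is the convolution in `t` of `f (x, ·)` with the Heaviside function, which is only
locally integrable; joint smoothness comes from that of `f`, with `x` as a parameter. -/
theorem contDiff_integral_Iic {f : E × ℝ → ℝ} (hf : ContDiff ℝ ∞ f) {k : Set ℝ}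
    (hk : IsCompact k) (hs : ∀ p : E × ℝ, p.2 ∉ k → f p = 0) :
    ContDiff ℝ ∞ fun p : E × ℝ => ∫ t in Iic p.2, f (p.1, t) := by
  have hH : LocallyIntegrable ((Ici (0 : ℝ)).indicator fun _ => (1 : ℝ)) :=
    (locallyIntegrable_const (1 : ℝ)).indicator measurableSet_Ici
  have h := contDiffOn_convolution_left_with_param (n := ⊤) (ContinuousLinearMap.mul ℝ ℝ)
    (g := fun (x : E) t => f (x, t)) isOpen_univ hk (fun x t _ ht => hs (x, t) ht) hH
    (by exact hf.contDiffOn)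
  rw [univ_prod_univ, contDiffOn_univ] at h
  convert h using 2 with p
  rw [convolution_def, ← integral_indicator measurableSet_Iic]
  congr 1 with t
  by_cases ht : t ≤ p.2 <;> simp [ht, indicator]

theorem hasDerivAt_integral_Iic {g : ℝ → ℝ} (hg : Continuous g) (hc : HasCompactSupport g)
    (s : ℝ) : HasDerivAt (fun s => ∫ t in Iic s, g t) (g s) s := by
  have hi : Integrable g := hg.integrable_of_hasCompactSupport hc
  have h : (fun s => ∫ t in Iic s, g t) = fun s => (∫ t in Iic 0, g t) + ∫ t in (0 : ℝ)..s, g t := by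
    ext s
    rw [← intervalIntegral.integral_Iic_sub_Iic hi.integrableOn hi.integrableOn]
    ring
  rw [h]
  exact (hg.integral_hasStrictDerivAt 0 s).hasDerivAt.const_add _

/-- The primitive from `-∞` vanishes below the support of `Φ`; above it, it equals the full integral
over the line, which is zero by hypothesis. So it is again a test function. -/
theorem exists_dirDeriv_eq_of_partialIntegral_eq_zero (Φ : 𝓓((⊤ : Opens (E × ℝ)), ℝ))
    (h : partialIntegral Φ = 0) : ∃ Ψ, dirDeriv (0, 1) Ψ = Φ := by
  have hK := Φ.hasCompactSupport.isCompact.image continuous_snd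
  have hs : ∀ p : E × ℝ, p.2 ∉ Prod.snd '' tsupport Φ → Φ p = 0 :=
    eq_zero_of_snd_notMem fun _ hp => image_eq_zero_of_notMem_tsupport hp
  obtain ⟨a, ha⟩ := hK.bddBelow
  obtain ⟨b, hb⟩ := hK.bddAbove
  have hab : ∀ x t, t ∉ Icc a b → Φ (x, t) = 0 := fun x t ht =>
    hs (x, t) fun h => ht ⟨ha h, hb h⟩
  have hsm := contDiff_integral_Iic Φ.contDiff hK hs
  let Ψ : 𝓓((⊤ : Opens (E × ℝ)), ℝ) := ⟨fun p => ∫ t in Iic p.2, Φ (p.1, t), hsm, by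
    refine HasCompactSupport.intro ((Φ.hasCompactSupport.isCompact.image continuous_fst).prod
      (isCompact_Icc (a := a) (b := b))) fun p hp => ?_
    by_cases hx : p.1 ∈ Prod.fst '' tsupport Φ
    · have hp2 : p.2 ∉ Icc a b := fun h' => hp ⟨hx, h'⟩
      by_cases hlt : p.2 < a
      · refine setIntegral_eq_zero_of_forall_eq_zero fun t ht => hab _ _ fun h' => ?_
        exact absurd (h'.1.trans ht) (not_le.2 hlt)
      · have hgt : b < p.2 := not_le.1 fun h' => hp2 ⟨not_lt.1 hlt, h'⟩
        have hout : ∀ t, t ∉ Iic p.2 → Φ (p.1, t) = 0 := fun t ht =>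
          hab _ _ fun h' => ht (h'.2.trans hgt.le)
        rw [setIntegral_eq_integral_of_forall_compl_eq_zero hout, ← partialIntegral_apply, h]
        rfl
    · refine setIntegral_eq_zero_of_forall_eq_zero fun t _ =>
        image_eq_zero_of_notMem_tsupport fun h' => hx ⟨_, h', rfl⟩, fun _ _ => trivial⟩
  refine ⟨Ψ, TestFunction.ext fun p => ?_⟩
  obtain ⟨x, s⟩ := p
  have h1 : HasDerivAt (fun s => Ψ (x, s)) (fderiv ℝ Ψ (x, s) (0, 1)) s :=
    (differentiable_testFunction Ψ (x, s)).hasFDerivAt.comp_hasDerivAt s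
      ((hasDerivAt_const s x).prodMk (hasDerivAt_id s))
  have h2 : HasDerivAt (fun s => Ψ (x, s)) (Φ (x, s)) s :=
    hasDerivAt_integral_Iic (Φ.continuous.comp (by fun_prop))
      (HasCompactSupport.intro hK fun t ht => hs (x, t) ht) s
  rw [dirDeriv_apply, h1.unique h2]

end Primitive

/-! ### Functionals with zero gradient are constant -/

section ZeroGradient

/-- Every linear functional on test functions vanishing on all derivatives is a multiple of the
integral. -/
def ConstantOfGradientZero (E : Type) [NormedAddCommGroup E] [NormedSpace ℝ E] [MeasureSpace E] :
    Prop :=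
  ∀ T : 𝓓((⊤ : Opens E), ℝ) →ₗ[ℝ] ℂ, (∀ v φ, T (dirDeriv v φ) = 0) →
    ∃ c : ℂ, ∀ φ, T φ = c * (∫ x, φ x : ℝ)

/-- `Φ` and `tensor ρ (partialIntegral Φ)` have the same partial integral, so they differ by a
derivative along `ℝ`, which `T` kills. Thus `T` factors through `partialIntegral`, the induced
functional on `E` is a multiple of the integral, and Fubini concludes. -/
theorem ConstantOfGradientZero.prod_real {E : Type} [NormedAddCommGroup E] [NormedSpace ℝ E]
    [MeasureSpace E] [BorelSpace E] [SecondCountableTopology E] [SFinite (volume : Measure E)]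
    [IsFiniteMeasureOnCompacts (volume : Measure (E × ℝ))]
    (hE : ConstantOfGradientZero E) : ConstantOfGradientZero (E × ℝ) := by
  intro T hT
  obtain ⟨ρ, hρ⟩ := exists_testFunction_integral_eq_one ℝ
  obtain ⟨c, hc⟩ := hE (T ∘ₗ tensor ρ) fun v φ => by
    rw [LinearMap.comp_apply, ← dirDeriv_tensor, hT]
  refine ⟨c, fun Φ => ?_⟩
  have h0 : partialIntegral (Φ - tensor ρ (partialIntegral Φ)) = 0 := by
    rw [map_sub, partialIntegral_tensor hρ, sub_self]
  obtain ⟨Ψ, hΨ⟩ := exists_dirDeriv_eq_of_partialIntegral_eq_zero _ h0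
  have h1 : T Φ = T (tensor ρ (partialIntegral Φ)) := by
    rw [← sub_eq_zero, ← map_sub, ← hΨ, hT]
  rw [h1, Measure.volume_eq_prod, integral_prod _ (integrable_testFunction Φ)]
  exact hc _

theorem ConstantOfGradientZero.of_equiv {E F : Type} [NormedAddCommGroup E] [NormedSpace ℝ E]
    [MeasureSpace E] [BorelSpace E] [NormedAddCommGroup F] [NormedSpace ℝ F] [MeasureSpace F]
    [BorelSpace F] (e : E ≃L[ℝ] F) (he : MeasurePreserving e) (hE : ConstantOfGradientZero E) :
    ConstantOfGradientZero F := by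
  intro T hT
  obtain ⟨c, hc⟩ := hE (T ∘ₗ (compEquiv e.symm : _ →L[ℝ] _)) fun v φ => by
    rw [LinearMap.comp_apply, ContinuousLinearMap.coe_coe, compEquiv_dirDeriv, hT]
  refine ⟨c, fun φ => ?_⟩
  have h1 : compEquiv e.symm (compEquiv e φ) = φ := TestFunction.ext fun x => by
    simp [compEquiv_apply]
  have h2 := hc (compEquiv e φ)
  rw [LinearMap.comp_apply, ContinuousLinearMap.coe_coe, h1] at h2
  rw [h2, ← he.integral_comp e.toHomeomorph.measurableEmbedding]
  rfl

theorem constantOfGradientZero_pi (d : ℕ) : ConstantOfGradientZero (Fin d → ℝ) := by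
  induction d with
  | zero =>
    intro T _
    obtain ⟨ρ, hρ⟩ := exists_testFunction_integral_eq_one (Fin 0 → ℝ)
    have hconst : ∀ φ : 𝓓((⊤ : Opens (Fin 0 → ℝ)), ℝ),
        ∫ x, φ x = (volume : Measure (Fin 0 → ℝ)).real univ * φ 0 := fun φ => by
      have : (φ : (Fin 0 → ℝ) → ℝ) = fun _ => φ 0 := funext fun x => by rw [Subsingleton.elim x 0]
      rw [this, integral_const, smul_eq_mul]
    refine ⟨T ρ, fun φ => ?_⟩
    -- On a one-point space all test functions are proportional, and `ρ` has integral one.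
    have : φ = (∫ x, φ x) • ρ := TestFunction.ext fun x => by
      rw [Subsingleton.elim x 0]
      change φ 0 = (∫ x, φ x) * ρ 0
      rw [hconst] at hρ ⊢
      linear_combination (-φ 0) * hρ
    conv_lhs => rw [this, map_smul, Complex.real_smul, mul_comm]
  | succ d ih =>
    -- The swap is needed because `prod_real` appends the new real variable last, whereas
    -- `Fin.consEquivL` puts it in front.
    refine ih.prod_real.of_equiv
      ((ContinuousLinearEquiv.prodComm ℝ _ _).trans (Fin.consEquivL ℝ fun _ => ℝ)) ?_
    have h := ((volume_preserving_piFinSuccAbove (fun _ : Fin (d + 1) => ℝ) 0).symm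
      (MeasurableEquiv.piFinSuccAbove _ 0)).comp
      (Measure.measurePreserving_swap (μ := (volume : Measure (Fin d → ℝ)))
        (ν := (volume : Measure ℝ)))
    have he : ⇑((ContinuousLinearEquiv.prodComm ℝ (Fin d → ℝ) ℝ).trans
        (Fin.consEquivL ℝ fun _ => ℝ)) =
        (MeasurableEquiv.piFinSuccAbove (fun _ => ℝ) 0).symm ∘ Prod.swap :=
      funext fun p => (Fin.insertNth_zero' p.2 p.1).symm
    rw [he]
    exact h

end ZeroGradient

/-! ### Coefficients of iterated derivatives of polynomials -/

section IteratedPartialDerivatives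

variable {σ : Type}

/-- The multi-index factorial `∏ i, (s i)!`. -/
def multiFactorial [Fintype σ] (s : σ →₀ ℕ) : ℕ := ∏ i, (s i).factorial

theorem multiFactorial_ne_zero [Fintype σ] (s : σ →₀ ℕ) : multiFactorial s ≠ 0 :=
  Finset.prod_ne_zero_iff.2 fun i _ => (s i).factorial_ne_zero

theorem multiFactorial_add_single [Fintype σ] [DecidableEq σ] (s : σ →₀ ℕ) (i : σ) :
    multiFactorial (s + Finsupp.single i 1) = multiFactorial s * (s i + 1) := by
  unfold multiFactorial
  rw [← Finset.mul_prod_erase _ _ (Finset.mem_univ i),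
    ← Finset.mul_prod_erase _ (fun j => (s j).factorial) (Finset.mem_univ i)]
  have : ∀ j ∈ Finset.univ.erase i,
      ((s + Finsupp.single i 1 : σ →₀ ℕ) j).factorial = (s j).factorial := fun j hj => by
    rw [Finsupp.add_apply, Finsupp.single_eq_of_ne (Finset.ne_of_mem_erase hj), add_zero]
  rw [Finset.prod_congr rfl this, Finsupp.add_apply, Finsupp.single_eq_same, Nat.factorial_succ]
  ring

/-- The iterated partial derivative of a polynomial along a list of variables. -/
noncomputable def iterPderiv (l : List σ) (p : MvPolynomial σ ℂ) : MvPolynomial σ ℂ :=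
  l.foldl (fun p i => MvPolynomial.pderiv i p) p

theorem iterPderiv_cons (i : σ) (l : List σ) (p : MvPolynomial σ ℂ) :
    iterPderiv (i :: l) p = iterPderiv l (MvPolynomial.pderiv i p) := rfl

variable [DecidableEq σ]

theorem toFinsupp_cons (i : σ) (l : List σ) :
    Multiset.toFinsupp ((i :: l : List σ) : Multiset σ) =
      Multiset.toFinsupp (l : Multiset σ) + Finsupp.single i 1 := by
  rw [← Multiset.cons_coe, ← Multiset.singleton_add, map_add, Multiset.toFinsupp_singleton,
    add_comm]

theorem degree_toFinsupp (l : List σ) :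
    (Multiset.toFinsupp (l : Multiset σ)).degree = l.length := by
  induction l with
  | nil => simp
  | cons i l ih => rw [toFinsupp_cons, map_add, ih, Finsupp.degree_single, List.length_cons]

/-- Weighting coefficients by factorials turns each partial derivative into a plain shift of the
multi-index. -/
theorem coeff_iterPderiv [Fintype σ] (l : List σ) (p : MvPolynomial σ ℂ) (t : σ →₀ ℕ) :
    (multiFactorial t : ℂ) * (iterPderiv l p).coeff t =
      multiFactorial (t + Multiset.toFinsupp (l : Multiset σ)) *
        p.coeff (t + Multiset.toFinsupp (l : Multiset σ)) := by
  induction l generalizing p with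
  | nil => simp [iterPderiv]
  | cons i l ih =>
    rw [iterPderiv_cons, ih, MvPolynomial.coeff_pderiv, toFinsupp_cons, ← add_assoc,
      multiFactorial_add_single]
    push_cast
    ring

theorem iterPderiv_eq_C [Fintype σ] {n : ℕ} {p : MvPolynomial σ ℂ} (hp : ∀ s ∈ p.support, s.degree ≤ n)
    {l : List σ} (hl : l.length = n) :
    iterPderiv l p = MvPolynomial.C (multiFactorial (Multiset.toFinsupp (l : Multiset σ)) *
      p.coeff (Multiset.toFinsupp (l : Multiset σ))) := by
  ext t
  have h := coeff_iterPderiv l p t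
  rw [MvPolynomial.coeff_C]
  split_ifs with ht
  · subst ht
    simpa [multiFactorial] using h
  -- For `t ≠ 0` the shifted index has degree above `n`.
  · have h0 : p.coeff (t + Multiset.toFinsupp (l : Multiset σ)) = 0 := by
      by_contra hne
      have h1 := hp _ (MvPolynomial.mem_support_iff.2 hne)
      rw [map_add, degree_toFinsupp, hl] at h1
      have h2 : t.degree = 0 := by omega
      exact ht ((Finsupp.degree_eq_zero_iff t).1 h2).symm
    rw [h0, mul_zero] at h
    exact (mul_eq_zero.1 h).resolve_left (Nat.cast_ne_zero.2 (multiFactorial_ne_zero t))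

end IteratedPartialDerivatives

/-! ### Functionals killing all derivatives of a given order -/

section PolynomialFunctionals

variable {d : ℕ}

theorem contDiff_evalReal (p : MvPolynomial (Fin d) ℂ) :
    ContDiff ℝ ∞ fun x : Fin d → ℝ => MvPolynomial.eval (fun i => (x i : ℂ)) p := by
  induction p using MvPolynomial.induction_on with
  | C a => simpa using contDiff_const
  | add p q hp hq => simpa using hp.add hq
  | mul_X p i hp =>
    simpa using hp.mul (Complex.ofRealCLM.contDiff.comp (contDiff_apply ℝ ℝ i))

theorem fderiv_evalReal (p : MvPolynomial (Fin d) ℂ) (i : Fin d) (x : Fin d → ℝ) :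
    fderiv ℝ (fun x : Fin d → ℝ => MvPolynomial.eval (fun i => (x i : ℂ)) p) x (Pi.single i 1) =
      MvPolynomial.eval (fun i => (x i : ℂ)) (MvPolynomial.pderiv i p) := by
  have hd : ∀ p : MvPolynomial (Fin d) ℂ, DifferentiableAt ℝ
      (fun x : Fin d → ℝ => MvPolynomial.eval (fun i => (x i : ℂ)) p) x :=
    fun p => (contDiff_evalReal p).differentiable (by simp) x
  induction p using MvPolynomial.induction_on with
  | C a => simp
  | add p q hp hq =>
    simp only [map_add]
    rw [fderiv_fun_add (hd p) (hd q), add_apply, hp, hq]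
  | mul_X p j hp =>
    have hj : HasFDerivAt (fun x : Fin d → ℝ => (x j : ℂ))
        (Complex.ofRealCLM ∘L ContinuousLinearMap.proj (R := ℝ) (φ := fun _ : Fin d => ℝ) j) x :=
      (Complex.ofRealCLM ∘L ContinuousLinearMap.proj (R := ℝ)
        (φ := fun _ : Fin d => ℝ) j).hasFDerivAt
    have h := ((hd p).hasFDerivAt.mul hj).fderiv
    simp only [map_mul, MvPolynomial.eval_X, Derivation.leibniz, MvPolynomial.pderiv_X,
      smul_eq_mul, map_add]
    refine (congrArg (fun L : (Fin d → ℝ) →L[ℝ] ℂ => L (Pi.single i 1)) h).trans ?_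
    by_cases hij : i = j
    · subst hij
      simp [hp]
    · simp [hp, Ne.symm hij]

theorem integrable_mul_testFunction {g : (Fin d → ℝ) → ℂ} (hg : Continuous g)
    (φ : 𝓓((⊤ : Opens (Fin d → ℝ)), ℝ)) : Integrable fun x => (φ x : ℂ) * g x := by
  have hφ := φ.continuous
  refine Continuous.integrable_of_hasCompactSupport (by fun_prop) ?_
  exact (φ.hasCompactSupport.comp_left (g := fun r : ℝ => (r : ℂ)) rfl).mul_right

/-- Integration of test functions against polynomials. -/
noncomputable def polyFunctional :
    MvPolynomial (Fin d) ℂ →ₗ[ℂ] 𝓓((⊤ : Opens (Fin d → ℝ)), ℝ) →ₗ[ℝ] ℂ :=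
  LinearMap.mk₂' ℂ ℝ (fun p φ => ∫ x, (φ x : ℂ) * MvPolynomial.eval (fun i => (x i : ℂ)) p)
    (fun p q φ => by
      rw [← integral_add (integrable_mul_testFunction (contDiff_evalReal p).continuous φ)
        (integrable_mul_testFunction (contDiff_evalReal q).continuous φ)]
      simp [mul_add])
    (fun c p φ => by
      rw [smul_eq_mul, ← integral_const_mul]
      simp [mul_left_comm])
    (fun p φ ψ => by
      rw [← integral_add (integrable_mul_testFunction (contDiff_evalReal p).continuous φ)
        (integrable_mul_testFunction (contDiff_evalReal p).continuous ψ)]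
      simp [add_mul])
    (fun c p φ => by
      rw [Complex.real_smul, ← integral_const_mul]
      simp [mul_assoc])

theorem polyFunctional_apply (p : MvPolynomial (Fin d) ℂ) (φ : 𝓓((⊤ : Opens (Fin d → ℝ)), ℝ)) :
    polyFunctional p φ = ∫ x, (φ x : ℂ) * MvPolynomial.eval (fun i => (x i : ℂ)) p := rfl

theorem polyFunctional_C (a : ℂ) (φ : 𝓓((⊤ : Opens (Fin d → ℝ)), ℝ)) :
    polyFunctional (MvPolynomial.C a) φ = a * (∫ x, φ x : ℝ) := by
  rw [polyFunctional_apply]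
  simp_rw [MvPolynomial.eval_C]
  rw [integral_mul_const, integral_complex_ofReal, mul_comm]

theorem polyFunctional_dirDeriv (p : MvPolynomial (Fin d) ℂ) (i : Fin d)
    (φ : 𝓓((⊤ : Opens (Fin d → ℝ)), ℝ)) :
    polyFunctional p (dirDeriv (Pi.single i 1) φ) =
      -polyFunctional (MvPolynomial.pderiv i p) φ := by
  have hφ : ∀ x, HasFDerivAt (fun x => (φ x : ℂ)) (Complex.ofRealCLM ∘L fderiv ℝ φ x) x := fun x =>
    Complex.ofRealCLM.hasFDerivAt.comp x (differentiable_testFunction φ x).hasFDerivAt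
  have hφ' : ∀ x, fderiv ℝ (fun x => (φ x : ℂ)) x (Pi.single i 1) =
      (dirDeriv (Pi.single i 1) φ x : ℂ) := fun x => by
    rw [(hφ x).fderiv, dirDeriv_apply]
    simp
  have h := integral_mul_fderiv_eq_neg_fderiv_mul_of_integrable
    (μ := (volume : Measure (Fin d → ℝ)))
    (f := fun x : Fin d → ℝ => MvPolynomial.eval (fun i => (x i : ℂ)) p)
    (g := fun x => (φ x : ℂ)) (v := Pi.single i 1)
    (by
      simp_rw [fderiv_evalReal]
      exact (integrable_mul_testFunction (contDiff_evalReal _).continuous _).congr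
        (.of_forall fun x => mul_comm _ _))
    (by
      simp_rw [hφ']
      exact (integrable_mul_testFunction (contDiff_evalReal _).continuous _).congr
        (.of_forall fun x => mul_comm _ _))
    ((integrable_mul_testFunction (contDiff_evalReal _).continuous _).congr
        (.of_forall fun x => mul_comm _ _))
    (fun x _ => (contDiff_evalReal p).differentiable (by simp) x)
    (fun x _ => (hφ x).differentiableAt)
  simp_rw [fderiv_evalReal, hφ'] at h
  rw [polyFunctional_apply, polyFunctional_apply]
  simpa only [mul_comm] using h

/-- The iterated partial derivative of a test function along a list of coordinates. -/
noncomputable def iterPartial (l : List (Fin d)) : Module.End ℝ 𝓓((⊤ : Opens (Fin d → ℝ)), ℝ) :=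
  iterDirDeriv (l.map fun i => (Pi.single i 1 : Fin d → ℝ))

/-- Integration by parts transfers the outermost derivative, the head of `l`, first; this is the
order in which the left fold in `iterPderiv` differentiates `p`. -/
theorem polyFunctional_iterPartial (p : MvPolynomial (Fin d) ℂ) (l : List (Fin d))
    (φ : 𝓓((⊤ : Opens (Fin d → ℝ)), ℝ)) :
    polyFunctional p (iterPartial l φ) =
      (-1) ^ l.length * polyFunctional (iterPderiv l p) φ := by
  induction l generalizing p with
  | nil => simp [iterPartial, iterDirDeriv_nil, iterPderiv]
  | cons i l ih =>
    have : iterPartial (i :: l) φ = dirDeriv (Pi.single i 1) (iterPartial l φ) := by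
      rw [iterPartial, List.map_cons, iterDirDeriv_cons]
      rfl
    rw [this, polyFunctional_dirDeriv, ih, iterPderiv_cons, List.length_cons]
    ring

theorem dirDeriv_eq_sum (v : Fin d → ℝ) (φ : 𝓓((⊤ : Opens (Fin d → ℝ)), ℝ)) :
    dirDeriv v φ = ∑ i, v i • dirDeriv (Pi.single i 1) φ := by
  have hs : ∀ (s : Finset (Fin d)) (F : Fin d → 𝓓((⊤ : Opens (Fin d → ℝ)), ℝ)) (x : Fin d → ℝ),
      (∑ i ∈ s, F i) x = ∑ i ∈ s, F i x := fun s F x => by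
    induction s using Finset.cons_induction with
    | empty => rfl
    | cons i s hi ih => rw [Finset.sum_cons, Finset.sum_cons, ← ih]; rfl
  ext x
  rw [hs]
  have h : ∀ i, (v i • dirDeriv (Pi.single i 1) φ) x = fderiv ℝ φ x (v i • Pi.single i 1) :=
    fun i => by rw [map_smul, ← dirDeriv_apply]; rfl
  simp_rw [h]
  rw [dirDeriv_apply, ← map_sum]
  congr 1
  ext j
  simp [Finset.sum_apply, Pi.single_apply]

/-- A linear functional on test functions annihilating all derivatives of order `n` is integration
against a polynomial of degree less than `n`. -/
theorem exists_polyFunctional_eq (n : ℕ) (T : 𝓓((⊤ : Opens (Fin d → ℝ)), ℝ) →ₗ[ℝ] ℂ)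
    (hT : ∀ l : List (Fin d), l.length = n → ∀ φ, T (iterPartial l φ) = 0) :
    ∃ p : MvPolynomial (Fin d) ℂ, (∀ s ∈ p.support, s.degree < n) ∧ T = polyFunctional p := by
  classical
  induction n generalizing T with
  | zero => exact ⟨0, by simp, by rw [map_zero]; exact LinearMap.ext fun φ => hT [] rfl φ⟩
  | succ n ih =>
    -- For `l` of length `n`, one further partial derivative reaches order `n + 1`, so `T ∘ₗ
    -- iterPartial l` has zero gradient. Lists of other lengths get the dummy value `0`.
    have hc : ∀ l : List (Fin d), ∃ c : ℂ, l.length = n →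
        ∀ φ, T (iterPartial l φ) = c * (∫ x, φ x : ℝ) := fun l => by
      by_cases hl : l.length = n
      · obtain ⟨c, hc⟩ := constantOfGradientZero_pi d (T ∘ₗ iterPartial l) fun v φ => by
          rw [dirDeriv_eq_sum, map_sum]
          refine Finset.sum_eq_zero fun i _ => ?_
          have h := hT (l ++ [i]) (by simp [hl]) φ
          rw [iterPartial, List.map_append, iterDirDeriv_append] at h
          rw [map_smul, LinearMap.comp_apply]
          exact (congrArg _ h).trans (smul_zero _)
        exact ⟨c, fun _ => hc⟩
      · exact ⟨0, fun h => absurd h hl⟩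
    choose c hc using hc
    let S := (Finsupp.finite_of_degree_le (σ := Fin d) n).toFinset.filter fun s => s.degree = n
    have hS : ∀ s, s ∈ S ↔ s.degree = n := fun s => by
      simp only [S, Finset.mem_filter, Set.Finite.mem_toFinset, Set.mem_ofPred_eq]
      exact ⟨fun h => h.2, fun h => ⟨h.le, h⟩⟩
    -- By parts, the coefficient `a` at `s` contributes `(-1) ^ n * multiFactorial s * a` to the
    -- constant of the derivative of multi-index `s`; `a` is chosen to make this `c`.
    let p : MvPolynomial (Fin d) ℂ := ∑ s ∈ S,
      MvPolynomial.monomial s ((-1) ^ n * c s.toMultiset.toList / multiFactorial s)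
    have hcoeff : ∀ s, p.coeff s = if s ∈ S then
        (-1) ^ n * c s.toMultiset.toList / multiFactorial s else 0 := fun s => by
      simp only [p, MvPolynomial.coeff_sum, MvPolynomial.coeff_monomial]
      rw [Finset.sum_ite_eq']
    have hp : ∀ s ∈ p.support, s.degree = n := fun s hs => by
      by_contra hne
      refine MvPolynomial.mem_support_iff.1 hs ?_
      rw [hcoeff, if_neg fun h => hne ((hS s).1 h)]
    obtain ⟨q, hq, hTq⟩ := ih (T - polyFunctional p) fun l hl φ => by
      set s := Multiset.toFinsupp (l : Multiset (Fin d)) with hs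
      have hsn : s.degree = n := (degree_toFinsupp l).trans hl
      -- The constant depends only on the multi-index of `l`, so it may be computed on the
      -- representative list used to define `p`.
      have hperm : l.Perm s.toMultiset.toList := by
        rw [← Multiset.coe_eq_coe, Multiset.coe_toList, hs, Multiset.toFinsupp_toMultiset]
      have h1 : T (iterPartial l φ) = c s.toMultiset.toList * (∫ x, φ x : ℝ) := by
        rw [iterPartial, iterDirDeriv_perm (hperm.map _)]
        exact hc _ (hperm.length_eq.symm.trans hl) φ
      have hfac : (multiFactorial s : ℂ) ≠ 0 := Nat.cast_ne_zero.2 (multiFactorial_ne_zero s)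
      have hsign : ((-1 : ℂ) ^ n) * (-1) ^ n = 1 := by rw [← mul_pow]; simp
      rw [LinearMap.sub_apply, h1, polyFunctional_iterPartial,
        iterPderiv_eq_C (fun s hs => (hp s hs).le) hl, ← hs, polyFunctional_C, hcoeff,
        if_pos ((hS s).2 hsn), hl, mul_div_cancel₀ _ hfac]
      linear_combination (-c s.toMultiset.toList * (∫ x, φ x : ℝ)) * hsign
    refine ⟨q + p, fun s hs => ?_, ?_⟩
    · rcases Finset.mem_union.1 (MvPolynomial.support_add hs) with h | h
      · exact (hq s h).trans n.lt_succ_self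
      · exact (hp s h).trans_lt n.lt_succ_self
    · rw [map_add, ← hTq, sub_add_cancel]

/-- The bound is an integer so that `n = 0`, where the empty derivative gives `T = 0`, is covered
with degree bound `-1`. -/
theorem isPolynomialOfDegreeLE_of_annihilates (n : ℕ) (T : Distr d)
    (hT : ∀ v : List (Fin d → ℝ), v.length = n → ∀ φ, T (iterDirDeriv v φ) = 0) :
    IsPolynomialOfDegreeLE T ((n : ℤ) - 1) := by
  obtain ⟨p, hp, hTp⟩ := exists_polyFunctional_eq n
    (⟨⟨T, map_add T⟩, map_smul T⟩ : 𝓓((⊤ : Opens (Fin d → ℝ)), ℝ) →ₗ[ℝ] ℂ)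
    fun l hl φ => hT _ (by simpa using hl) φ
  refine ⟨p, fun s hs => ?_, fun φ => LinearMap.congr_fun hTp φ⟩
  have := hp s hs
  omega

end PolynomialFunctionals

end DistEq

theorem theorem5 (d m : ℕ) (f : Fin m → DistEq.Distr d) (P Q : DistEq.Distr d)
    (b c : Fin m → Matrix.GeneralLinearGroup (Fin d) ℝ)
    (hbc : ∀ i j, i ≠ j → IsUnit
      ((((b i)⁻¹ * c i : Matrix.GeneralLinearGroup (Fin d) ℝ) : Matrix (Fin d) (Fin d) ℝ) -
        (((b j)⁻¹ * c j : Matrix.GeneralLinearGroup (Fin d) ℝ) : Matrix (Fin d) (Fin d) ℝ)))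
    (heq : ∑ i, DistEq.compSum (f i) (b i) (c i) = DistEq.tensorOne P + DistEq.oneTensor Q) :
    (DistEq.IsPolynomialOfDegreeLE P m ∧ DistEq.IsPolynomialOfDegreeLE Q m) ∧
      (Q = 0 → DistEq.IsPolynomialOfDegreeLE P ((m : ℤ) - 1)) ∧
      (P = 0 → DistEq.IsPolynomialOfDegreeLE Q ((m : ℤ) - 1)) := by
  -- In the general case derivatives of order `m + 1` are killed, which gives degree at most `m`.
  have hm : (m : ℤ) = ((m + 1 : ℕ) : ℤ) - 1 := by push_cast; ring
  refine ⟨⟨?_, ?_⟩, fun hQ => ?_, fun hP => ?_⟩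
  · rw [hm]
    exact DistEq.isPolynomialOfDegreeLE_of_annihilates _ _ fun _ hv φ =>
      DistEq.fst_annihilates heq hv φ
  · rw [hm]
    exact DistEq.isPolynomialOfDegreeLE_of_annihilates _ _ fun _ hv φ =>
      DistEq.snd_annihilates heq hv φ
  · exact DistEq.isPolynomialOfDegreeLE_of_annihilates _ _ fun _ hv φ =>
      DistEq.fst_annihilates_of_snd_eq_zero heq hQ hv φ
  · exact DistEq.isPolynomialOfDegreeLE_of_annihilates _ _ fun _ hv φ =>
      DistEq.snd_annihilates_of_fst_eq_zero heq hP hv φ
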